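/- Consider five bodies in the plane with positions $q_1,\dots,q_5\in\mathbb R^2$, mutual distances $r_{i,j}=|q_i-q_j|$, oriented areas $\Delta_{i,j,k}=(q_i-q_j)\wedge(q_i-q_k)$, and masses $m_1,\dots,m_5$. For a real exponent $A$, the positions form a central configuration for these masses if they are pairwise distinct and there is $\lambda\in\mathbb R$ with $$\lambda(q_i-c)=\sum_{j\ne i}\frac{m_j(q_i-q_j)}{r_{i,j}^{A}}\qquad(i=1,\dots,5),\qquad c=\frac{\sum_i m_iq_i}{\sum_i m_i}.$$ A normalized symmetric equilateral pentagon is a configuration $q_1=(-\tfrac12,0)$, $q_2=(\tfrac12,0)$, $q_3=(x_3,y_3)$, $q_4=(0,y_4)$, $q_5=(-x_3,y_3)$ with $r_{1,2}=r_{2,3}=r_{3,4}=r_{4,5}=r_{5,1}=1$. It belongs to branch B if $y_4\ge 0$ and $$y_3=\frac{8y_4^3+2y_4-\sqrt{-16y_4^4+56y_4^2+15}}{4(4y_4^2+1)},\qquad x_3=\frac{4y_4^2+1-2y_4\sqrt{-16y_4^4+56y_4^2+15}}{4(4y_4^2+1)}.$$ It is of type B2 if its points are in strictly convex position, $\Delta_{1,2,3}<0$,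 $\Delta_{1,3,4}>0$, $\Delta_{1,3,5}>0$, $\Delta_{1,4,5}<0$, $\Delta_{3,4,5}<0$, and $r_{1,3},r_{1,4},r_{3,5}<1$. Theorem 3. There is a branch B configuration $q$ whose five points are the vertices of a regular pentagon and which is of type B2, such that for every real $A\ge 2$ and all positive masses $m_1,\dots,m_5$, a branch B configuration $p$ is a central configuration for these masses if and only if $p=q$ and $m_1=\dots=m_5$. In particular, for every $A\ge2$ the only branch B central configuration with positive masses is the regular pentagon. -/

import Mathlib

/-- The plane of positions, with its Euclidean norm. -/
abbrev Plane : Type := EuclideanSpace ℝ (Fin 2)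

/-- The center of mass of five bodies at `q` with masses `m`. -/
noncomputable def centerOfMass (m : Fin 5 → ℝ) (q : Fin 5 → Plane) : Plane :=
  (∑ i, m i)⁻¹ • ∑ i, m i • q i

/-- `q` is a (collision-free) central configuration for the masses `m` and the exponent `A`: for
some real `lam`, `lam (q_i - c) = ∑_{j ≠ i} m_j (q_i - q_j) / r_{ij}^A` for every `i`. -/
def IsCentralConfiguration (A : ℝ) (m : Fin 5 → ℝ) (q : Fin 5 → Plane) : Prop :=
  Function.Injective q ∧
    ∃ lam : ℝ, ∀ i, lam • (q i - centerOfMass m q) =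
      ∑ j ∈ Finset.univ.erase i, (m j / dist (q i) (q j) ^ A) • (q i - q j)

/-- The oriented area `Δ_{i,j,k} = (q_i - q_j) ∧ (q_i - q_k)`. -/
def orientedArea (q : Fin 5 → Plane) (i j k : Fin 5) : ℝ :=
  (q i 0 - q j 0) * (q i 1 - q k 1) - (q i 1 - q j 1) * (q i 0 - q k 0)

/-- A symmetric equilateral pentagon, normalized so that `q_1 = (-1/2, 0)`, `q_2 = (1/2, 0)` and the
axis of symmetry is the line `x = 0`. The bodies 1, …, 5 are indexed by 0, …, 4, and `i + 1` is
cyclic, so `equilateral` says `r_{12} = r_{23} = r_{34} = r_{45} = r_{51} = 1`. -/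
structure IsNormalizedSymmetricEquilateral (q : Fin 5 → Plane) : Prop where
  q1_eq : q 0 = !₂[-1 / 2, 0]
  q2_eq : q 1 = !₂[1 / 2, 0]
  q4_on_axis : q 3 0 = 0
  q5_mirror_q3 : q 4 = !₂[-(q 2 0), q 2 1]
  equilateral : ∀ i, dist (q i) (q (i + 1)) = 1

/-- The branch of the normalized symmetric equilateral pentagons with `y_4 ≥ 0` on which the square
root in the parametrization of `q_3 = (x_3, y_3)` by `y_4` is taken with the negative sign.
The radicand is nonnegative on every normalized symmetric equilateral pentagon. -/
structure IsBranchB (q : Fin 5 → Plane) : Prop extends IsNormalizedSymmetricEquilateral q where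
  y4_nonneg : 0 ≤ q 3 1
  y3_eq : q 2 1 = (8 * q 3 1 ^ 3 + 2 * q 3 1 - √(-16 * q 3 1 ^ 4 + 56 * q 3 1 ^ 2 + 15)) /
    (4 * (4 * q 3 1 ^ 2 + 1))
  x3_eq : q 2 0 = (4 * q 3 1 ^ 2 + 1 - 2 * q 3 1 * √(-16 * q 3 1 ^ 4 + 56 * q 3 1 ^ 2 + 15)) /
    (4 * (4 * q 3 1 ^ 2 + 1))

/-- The five points are, in some order, the vertices of a (nondegenerate) regular pentagon. -/
def IsRegularPentagon (q : Fin 5 → Plane) : Prop :=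
  ∃ (σ : Equiv.Perm (Fin 5)) (c : Plane) (R θ : ℝ), 0 < R ∧ ∀ k : Fin 5,
    q (σ k) = c + !₂[R * Real.cos (θ + 2 * Real.pi * ((k : ℕ) : ℝ) / 5),
      R * Real.sin (θ + 2 * Real.pi * ((k : ℕ) : ℝ) / 5)]

/-- Type B2: strictly convex position together with the prescribed signs of oriented areas and sizes
of mutual distances relative to `r_{12} = 1`. -/
structure IsTypeB2 (q : Fin 5 → Plane) : Prop where
  convex : ConvexIndependent ℝ q
  area123 : orientedArea q 0 1 2 < 0
  area134 : 0 < orientedArea q 0 2 3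
  area135 : 0 < orientedArea q 0 2 4
  area145 : orientedArea q 0 3 4 < 0
  area345 : orientedArea q 2 3 4 < 0
  r13_lt : dist (q 0) (q 2) < 1
  r14_lt : dist (q 0) (q 3) < 1
  r35_lt : dist (q 2) (q 4) < 1

/-! In the coordinates `w = 2 y_4` and `s`, where `(1 + w ^ 2) (1 + s ^ 2) = 16` and `w, s ≥ 0`,
branch B consists of the configurations `pentagon w s` (`isBranchB_pentagon`,
`IsBranchB.exists_eq_pentagon`), with `x_3 = (1 - w s) / 4` and `y_3 = (w - s) / 4`. By symmetry the
only distances besides the sides are `r13 = r25`, `r14 = r24` and `r35`.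

Every central configuration satisfies the Laura–Andoyer equations
`∑ k, m_k (r_ik ^ (-A) - r_jk ^ (-A)) Δ_ijk = 0`
(`IsCentralConfiguration.sum_inv_dist_sub_mul_orientedArea`). For positive masses, the signs in the
equations of the pairs `1, 3` and `1, 4` leave only the arc `x_3 < 0`, `y_3 < 0`
(`IsCentralConfiguration.lt_and_one_lt`), where all of `r13`, `r14`, `r35` are less than `1`. On this
arc the pairs `1, 2` and `3, 5` give `m_3 = m_5` and `m_1 = m_2`. Put `t = -2 x_3 = r35` and
`S = (s + w) / 2`. With `μ = m_2 / m_5` and `a, b, c` for `r13 ^ (-A)`, `r14 ^ (-A)`, `r35 ^ (-A)`,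
the pairs `1, 4` and `3, 4` become
`μ w (b - 1) = (a - 1) (S - t w) / 2` and `μ (μ + t) w (b - 1) = (c - 1) t S`.

The regular pentagon is `t = g = (√5 - 1) / 2`, where the three distances coincide; for `t > g` they
are ordered `r13 ≤ r14 ≤ r35`, and for `t < g` the other way round. As `A / 2 ≥ 1`, convexity of
`z ↦ z ^ (A / 2)` bounds `(a - 1) / (b - 1)` by its value at `A = 2`
(`rpow_sub_one_mul_le`), from below for `t > g` and from above for `t < g`, while
`(c - 1) / (b - 1)` is compared with `1`. Together with `t S ≤ (1 + g) w`, in which equality holds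
at the regular pentagon (`mul_le_one_add_mul`), these bounds exclude `t > g` (`le_of_balance`) and
`t < g` (`ge_of_balance`). At `t = g` the equations force equal masses
(`IsCentralConfiguration.eq_regular`). -/

/-! ### The Laura–Andoyer equations -/

/-- The Laura–Andoyer equation of the pair `i, j`. It is the wedge product of `q_i - q_j` with the
difference of the equations of the bodies `i` and `j`, from which the multiplier and the center of
mass drop out. -/
theorem IsCentralConfiguration.sum_inv_dist_sub_mul_orientedArea {A : ℝ} {m : Fin 5 → ℝ}
    {q : Fin 5 → Plane} (h : IsCentralConfiguration A m q) (i j : Fin 5) :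
    ∑ k, m k * ((dist (q i) (q k) ^ A)⁻¹ - (dist (q j) (q k) ^ A)⁻¹) * orientedArea q i j k = 0 := by
  obtain ⟨-, lam, hl⟩ := h
  have key (i : Fin 5) (a : Fin 2) : lam * (q i a - centerOfMass m q a) =
      ∑ k, m k * (dist (q i) (q k) ^ A)⁻¹ * (q i a - q k a) := by
    have := congrArg (fun v : Plane => v a) (hl i)
    rw [Finset.sum_erase _ (by simp)] at this
    simpa [div_eq_mul_inv] using this
  have hi0 := key i 0
  have hi1 := key i 1
  have hj0 := key j 0
  have hj1 := key j 1
  simp only [Fin.sum_univ_five, orientedArea] at *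
  linear_combination (q i 0 - q j 0) * (hj1 - hi1) - (q i 1 - q j 1) * (hj0 - hi0)

/-! ### Coordinates on branch B -/

/-- The symmetric configuration with `q_4 = (0, w / 2)` whose third body is
`((1 - w s) / 4, (w - s) / 4)`. In these coordinates all five sides are `1` if and only if
`(1 + w ^ 2) (1 + s ^ 2) = 16`, and the square root in the parametrization of branch B becomes
`s (1 + w ^ 2)`, so that branch B is the part `0 ≤ w`, `0 ≤ s` of this curve. -/
noncomputable def pentagon (w s : ℝ) : Fin 5 → Plane :=
  ![!₂[-1 / 2, 0], !₂[1 / 2, 0], !₂[(1 - w * s) / 4, (w - s) / 4], !₂[0, w / 2],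
    !₂[-((1 - w * s) / 4), (w - s) / 4]]

theorem Plane.dist_eq (a b c d : ℝ) :
    dist (!₂[a, b] : Plane) !₂[c, d] = √((a - c) ^ 2 + (b - d) ^ 2) := by
  simp [EuclideanSpace.dist_eq, Fin.sum_univ_two, Real.dist_eq, sq_abs]

theorem dist_pentagon_edge {w s : ℝ} (h : (1 + w ^ 2) * (1 + s ^ 2) = 16) (i : Fin 5) :
    dist (pentagon w s i) (pentagon w s (i + 1)) = 1 := by
  fin_cases i <;> simp only [pentagon, Fin.isValue, Fin.reduceFinMk, Fin.reduceAdd, Fin.zero_eta,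
      zero_add, Fin.mk_one, Matrix.cons_val, Plane.dist_eq, Real.sqrt_eq_one]
  · norm_num
  · linear_combination h / 16
  · linear_combination h / 16
  · linear_combination h / 16
  · linear_combination h / 16

theorem isBranchB_pentagon {w s : ℝ} (hw : 0 ≤ w) (hs : 0 ≤ s)
    (h : (1 + w ^ 2) * (1 + s ^ 2) = 16) :
    IsBranchB (pentagon w s) := by
  have hr : √(-16 * (w / 2) ^ 4 + 56 * (w / 2) ^ 2 + 15) = s * (1 + w ^ 2) := by
    rw [show -16 * (w / 2) ^ 4 + 56 * (w / 2) ^ 2 + 15 = (s * (1 + w ^ 2)) ^ 2 by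
      linear_combination -(1 + w ^ 2) * h]
    exact Real.sqrt_sq (by positivity)
  refine ⟨⟨rfl, rfl, rfl, rfl, ?_⟩, ?_, ?_, ?_⟩
  · exact dist_pentagon_edge h
  · change 0 ≤ w / 2
    positivity
  · change (w - s) / 4 = (8 * (w / 2) ^ 3 + 2 * (w / 2) -
      √(-16 * (w / 2) ^ 4 + 56 * (w / 2) ^ 2 + 15)) / (4 * (4 * (w / 2) ^ 2 + 1))
    rw [hr, eq_div_iff (by positivity)]
    ring
  · change (1 - w * s) / 4 = (4 * (w / 2) ^ 2 + 1 - 2 * (w / 2) *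
      √(-16 * (w / 2) ^ 4 + 56 * (w / 2) ^ 2 + 15)) / (4 * (4 * (w / 2) ^ 2 + 1))
    rw [hr, eq_div_iff (by positivity)]
    ring

theorem IsBranchB.exists_eq_pentagon {q : Fin 5 → Plane} (h : IsBranchB q) :
    ∃ w s : ℝ, 0 ≤ w ∧ 0 ≤ s ∧ (1 + w ^ 2) * (1 + s ^ 2) = 16 ∧ q = pentagon w s := by
  obtain ⟨⟨h0, h1, h3, h4, he⟩, hw, hy, hx⟩ := h
  set r := √(-16 * q 3 1 ^ 4 + 56 * q 3 1 ^ 2 + 15)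
  have hr : 0 ≤ r := Real.sqrt_nonneg _
  set w := q 3 1
  have hx' : q 2 0 = (1 - 2 * w * (r / (4 * w ^ 2 + 1))) / 4 := by
    rw [hx]; field_simp
  have hy' : q 2 1 = (2 * w - r / (4 * w ^ 2 + 1)) / 4 := by
    rw [hy]; field_simp; ring
  have e2 : q 2 = !₂[q 2 0, q 2 1] := by ext i; fin_cases i <;> rfl
  have e3 : q 3 = !₂[0, w] := by ext i; fin_cases i <;> simp [h3, w]
  refine ⟨2 * w, r / (4 * w ^ 2 + 1), by positivity, by positivity, ?_, ?_⟩
  · have := he 2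
    rw [show (2 : Fin 5) + 1 = 3 from rfl, e2, e3, Plane.dist_eq, Real.sqrt_eq_one, hx', hy'] at this
    linear_combination 16 * this
  · ext i a
    fin_cases i
    · simp [h0, pentagon]
    · simp [h1, pentagon]
    · fin_cases a <;> simp [pentagon, hx', hy']
    · fin_cases a <;> simp [pentagon, h3, w]
    · fin_cases a <;> simp [h4, pentagon, hx', hy']

/-- The chord slopes of the convex function `z ↦ z ^ k` from the point `1` increase. This is where
the hypothesis `2 ≤ A` enters: it reduces the exponent `A` to the exponent `2`. -/
theorem rpow_sub_one_mul_le {z z' k : ℝ} (hk : 1 ≤ k) (hz : 1 < z) (hzz' : z ≤ z') :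
    (z ^ k - 1) * (z' - 1) ≤ (z' ^ k - 1) * (z - 1) := by
  have := (convexOn_rpow hk).secant_mono (a := 1) (x := z) (y := z') (by simp)
    (by simp; linarith) (by simp; linarith) (by linarith) (by linarith) hzz'
  rw [Real.one_rpow, div_le_div_iff₀ (by linarith) (by linarith)] at this
  exact this

theorem sqrt_rpow_inv {x : ℝ} (hx : 0 ≤ x) (A : ℝ) : (√x ^ A)⁻¹ = x⁻¹ ^ (A / 2) := by
  rw [Real.sqrt_eq_rpow, Real.inv_rpow hx, ← Real.rpow_mul hx, one_div_mul_eq_div]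

theorem one_lt_inv_rpow {x k : ℝ} (hx : 0 < x) (hx1 : x < 1) (hk : 0 < k) : 1 < x⁻¹ ^ k :=
  Real.one_lt_rpow ((one_lt_inv₀ hx).2 hx1) hk

theorem inv_rpow_lt_one {x k : ℝ} (hx : 1 < x) (hk : 0 < k) : x⁻¹ ^ k < 1 :=
  Real.rpow_lt_one (by positivity) (inv_lt_one_of_one_lt₀ hx) hk

/-! ### The shape inequalities -/

section Shape

-- In terms of the pentagon, `t = r35 = -2 x_3`, `S = 2 (y_4 - y_3)`, `H = -2 y_3`,
-- `w = 2 y_4 = S - H`, so that `r13 ^ 2 = 1 - t` and `r14 ^ 2 = (1 + w ^ 2) / 4`, and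
-- `g = (√5 - 1) / 2` is the value of `t` for the regular pentagon.
variable {S H t g : ℝ}

/-- `r14 ≤ r35` on the side `g ≤ t` of the regular pentagon. -/
theorem one_add_sq_le_four_mul_sq (hS : S ^ 2 = 4 - t ^ 2) (hH : H ^ 2 = (1 - t) * (3 + t))
    (hS0 : 0 < S) (hH0 : 0 < H) (ht0 : 0 < t) (ht1 : t < 1) (ht : 0 ≤ t ^ 2 + t - 1) :
    1 + (S - H) ^ 2 ≤ 4 * t ^ 2 := by
  have h : (1 - t) * (4 + 3 * t) ≤ S * H := by
    refine le_of_sq_le_sq ?_ (by positivity)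
    have : 0 ≤ (1 - t) * (4 * (2 * t + 1) * (t ^ 2 + t - 1)) :=
      mul_nonneg (by linarith) (by positivity)
    rw [mul_pow S, hS, hH]
    linarith
  linarith

/-- `r35 ≤ r14` on the side `t ≤ g` of the regular pentagon. -/
theorem four_mul_sq_le_one_add_sq (hS : S ^ 2 = 4 - t ^ 2) (hH : H ^ 2 = (1 - t) * (3 + t))
    (ht0 : 0 < t) (ht1 : t < 1) (ht : t ^ 2 + t - 1 ≤ 0) :
    4 * t ^ 2 ≤ 1 + (S - H) ^ 2 := by
  have h : S * H ≤ (1 - t) * (4 + 3 * t) := by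
    refine le_of_sq_le_sq ?_ (mul_nonneg (by linarith) (by linarith))
    have : 0 ≤ (1 - t) * (4 * (2 * t + 1) * (1 - t ^ 2 - t)) :=
      mul_nonneg (by linarith) (mul_nonneg (by linarith) (by linarith))
    rw [mul_pow S, hS, hH]
    linarith
  linarith

/-- `r13 ≤ r14` on the side `g ≤ t` of the regular pentagon. -/
theorem three_sub_le_sq (hS : S ^ 2 = 4 - t ^ 2) (hH : H ^ 2 = (1 - t) * (3 + t))
    (ht0 : 0 < t) (ht1 : t < 1) (ht : 0 ≤ t ^ 2 + t - 1) :
    3 - 4 * t ≤ (S - H) ^ 2 := by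
  have h : S * H ≤ (2 - t) * (1 + t) := by
    refine le_of_sq_le_sq ?_ (mul_nonneg (by linarith) (by linarith))
    have : 0 ≤ (2 - t) * (4 * (t ^ 2 + t - 1)) := mul_nonneg (by linarith) (by linarith)
    rw [mul_pow S, hS, hH]
    linarith
  linarith

/-- `r14 ≤ r13` on the side `t ≤ g` of the regular pentagon. -/
theorem sq_le_three_sub (hS : S ^ 2 = 4 - t ^ 2) (hH : H ^ 2 = (1 - t) * (3 + t))
    (hS0 : 0 < S) (hH0 : 0 < H) (ht1 : t < 1) (ht : t ^ 2 + t - 1 ≤ 0) :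
    (S - H) ^ 2 ≤ 3 - 4 * t := by
  have h : (2 - t) * (1 + t) ≤ S * H := by
    refine le_of_sq_le_sq ?_ (by positivity)
    have : 0 ≤ (2 - t) * (4 * (1 - t ^ 2 - t)) := mul_nonneg (by linarith) (by linarith)
    rw [mul_pow S, hS, hH]
    linarith
  linarith

/-- On the side `g ≤ t`, the distance `r14` is at least its value `g` at the regular pentagon. -/
theorem three_sub_four_mul_le_sq (hS : S ^ 2 = 4 - t ^ 2) (hH : H ^ 2 = (1 - t) * (3 + t))
    (ht0 : 0 < t) (ht1 : t < 1) (hg : g ^ 2 + g = 1) (hg0 : 0 < g) (hgt : g ≤ t) :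
    3 - 4 * g ≤ (S - H) ^ 2 := by
  have h : S * H ≤ 2 + 2 * g - t - t ^ 2 := by
    have h1 : 1 ≤ t + t ^ 2 := by nlinarith
    refine le_of_sq_le_sq ?_ (by nlinarith)
    have : 0 ≤ 4 * (1 - g) * (t + t ^ 2 - 1) := mul_nonneg (by linarith) (by linarith)
    rw [mul_pow S, hS, hH]
    linear_combination this - 4 * hg
  linarith

/-- On the side `t ≤ g`, the distance `r14` is at most its value `g` at the regular pentagon. -/
theorem sq_le_three_sub_four_mul (hS : S ^ 2 = 4 - t ^ 2) (hH : H ^ 2 = (1 - t) * (3 + t))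
    (hS0 : 0 < S) (hH0 : 0 < H) (ht0 : 0 < t) (hg : g ^ 2 + g = 1) (hg0 : 0 < g) (hgt : t ≤ g) :
    (S - H) ^ 2 ≤ 3 - 4 * g := by
  have h : 2 + 2 * g - t - t ^ 2 ≤ S * H := by
    have h1 : t + t ^ 2 ≤ 1 := by nlinarith
    refine le_of_sq_le_sq ?_ (by positivity)
    have : 0 ≤ 4 * (1 - g) * (1 - t - t ^ 2) := mul_nonneg (by nlinarith) (by linarith)
    rw [mul_pow S, hS, hH]
    linear_combination this + 4 * hg
  linarith

/-- The quotient `t S / w` is maximal at the regular pentagon `t = g`, which is why the difference of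
the two squares compared in the proof has the double root `g`. -/
theorem mul_le_one_add_mul (hS : S ^ 2 = 4 - t ^ 2) (hH : H ^ 2 = (1 - t) * (3 + t))
    (hS0 : 0 < S) (ht0 : 0 < t) (ht1 : t < 1) (hg : g ^ 2 + g = 1) (hg0 : 0 < g) :
    t * S ≤ (1 + g) * (S - H) := by
  have h : (1 + g) * H ≤ S * (1 + g - t) := by
    refine le_of_sq_le_sq ?_ (mul_nonneg hS0.le (by linarith))
    have : 0 ≤ (t - g) ^ 2 * (t * (2 - t) + (1 + g) ^ 4) :=
      mul_nonneg (sq_nonneg _) (add_nonneg (mul_nonneg ht0.le (by linarith)) (by positivity))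
    rw [mul_pow S, mul_pow _ H, hS, hH]
    have e : g ^ 2 = 1 - g := by linarith
    have e3 : g ^ 3 = 2 * g - 1 := by linear_combination (g - 1) * hg
    have e4 : g ^ 4 = 2 - 3 * g := by linear_combination (g ^ 2 - g + 2) * hg
    have e5 : g ^ 5 = 5 * g - 3 := by linear_combination (g ^ 3 - g ^ 2 + 2 * g - 3) * hg
    have e6 : g ^ 6 = 5 - 8 * g := by
      linear_combination (g ^ 4 - g ^ 3 + 2 * g ^ 2 - 3 * g + 5) * hg
    ring_nf at this ⊢
    simp only [e, e3, e4, e5, e6] at this ⊢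
    linarith
  linarith

/-- For `A = 2` and `r14` replaced by its lower bound `g`, the Laura–Andoyer equation of the pair
`1, 4` gives the mass ratio `m_2 / m_3 = g t (S - t w) / (2 (1 - t) w)`; this is at least `1` for
`g ≤ t`. -/
theorem two_mul_one_sub_mul_le (hS : S ^ 2 = 4 - t ^ 2) (hH : H ^ 2 = (1 - t) * (3 + t))
    (hH0 : 0 < H) (ht0 : 0 < t) (ht1 : t < 1) (hg : g ^ 2 + g = 1) (hg0 : 0 < g) (hgt : g ≤ t) :
    2 * (1 - t) * (S - H) ≤ g * t * (S - t * (S - H)) := by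
  have h : S * ((1 - t) * (2 - g * t)) ≤ H * (g * t ^ 2 + 2 * (1 - t)) := by
    have h1 : 0 < 1 - t := by linarith
    refine le_of_sq_le_sq ?_ (by positivity)
    have h2 : 0 ≤ g ^ 2 * t ^ 3 - 2 * g * t ^ 2 + (1 - 2 * g ^ 2) * t + (1 + g) := by
      have : g < 1 := by nlinarith
      have := mul_nonneg hg0.le (sq_nonneg (1 - t))
      have : 0 ≤ g ^ 2 * t ^ 3 := by positivity
      nlinarith
    have h3 := mul_nonneg (mul_nonneg h1.le (by linarith : 0 ≤ t - g)) h2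
    rw [mul_pow S, mul_pow H, hS, hH]
    have e : g ^ 2 = 1 - g := by linarith
    have e3 : g ^ 3 = 2 * g - 1 := by linear_combination (g - 1) * hg
    ring_nf at h3 ⊢
    simp only [e, e3] at h3 ⊢
    linarith
  linarith

end Shape

/-! ### The balance of the masses forces the regular shape -/

section Balance

-- The numbers `a`, `b`, `c` are `r13 ^ (-A)`, `r14 ^ (-A)`, `r35 ^ (-A)` with `k = A / 2`, and `μ` is
-- the mass ratio `m_1 / m_3 = m_2 / m_5`.
variable {S H t g w k μ a b c : ℝ}

/-- If `g < t`, then `r13 ≤ r14 ≤ r35`: the first balance condition gives `1 ≤ μ`, and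
`μ (μ + t) ≥ 1 + t > 1 + g ≥ t S / w` contradicts the second one, as `c ≤ b`. -/
theorem le_of_balance (hS : S ^ 2 = 4 - t ^ 2) (hH : H ^ 2 = (1 - t) * (3 + t))
    (hS0 : 0 < S) (hH0 : 0 < H) (ht0 : 0 < t) (ht1 : t < 1) (hw : w = S - H) (hw0 : 0 < w)
    (hw3 : w ^ 2 < 3) (hg : g ^ 2 + g = 1) (hg0 : 0 < g) (hk : 1 ≤ k)
    (ha : a = (1 - t)⁻¹ ^ k) (hb : b = ((1 + w ^ 2) / 4)⁻¹ ^ k) (hc : c = (t ^ 2)⁻¹ ^ k)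
    (h1 : μ * w * (b - 1) = (a - 1) * (S - t * w) / 2)
    (h2 : μ * (μ + t) * w * (b - 1) = (c - 1) * t * S) : t ≤ g := by
  by_contra! hgt
  have hu := three_sub_four_mul_le_sq hS hH ht0 ht1 hg hg0 hgt.le
  have hu' := three_sub_le_sq hS hH ht0 ht1 (by nlinarith)
  have hv := one_add_sq_le_four_mul_sq hS hH hS0 hH0 ht0 ht1 (by nlinarith)
  have hts := mul_le_one_add_mul hS hH hS0 ht0 ht1 hg hg0
  have hst := two_mul_one_sub_mul_le hS hH hH0 ht0 ht1 hg hg0 hgt.le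
  rw [← hw] at hu hu' hv hts hst
  have ht1' : 0 < 1 - t := by linarith
  have hu1 : (1 : ℝ) < ((1 + w ^ 2) / 4)⁻¹ := by
    rw [one_lt_inv₀ (by positivity)]; linarith
  have hb1 : 0 < b - 1 := by
    rw [hb]; linarith [Real.one_lt_rpow hu1 (by linarith : 0 < k)]
  have hcb : c ≤ b := by
    rw [hb, hc]
    gcongr
    linarith
  have hp : ((1 + w ^ 2) / 4)⁻¹ ≤ (1 - t)⁻¹ := by
    gcongr
    linarith
  have hab := rpow_sub_one_mul_le hk hu1 hp
  rw [← ha, ← hb] at hab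
  have hba : b ≤ a := by
    rw [ha, hb]
    gcongr
  have hab' : (b - 1) * (g * t) ≤ (a - 1) * (1 - t) := by
    have hU : ((1 + w ^ 2) / 4)⁻¹ ≤ 2 + g := by
      rw [inv_le_iff_one_le_mul₀ (by positivity)]
      linear_combination (2 + g) / 4 * hu + hg
    calc (b - 1) * (g * t) = (b - 1) * ((1 - t)⁻¹ - 1) * (g * (1 - t)) := by field_simp; ring
      _ ≤ (a - 1) * ((2 + g) - 1) * (g * (1 - t)) := by
        gcongr ?_ * _
        refine hab.trans ?_
        gcongr
        linarith
      _ = (a - 1) * (1 - t) := by linear_combination (a - 1) * (1 - t) * hg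
  have hμ : 1 ≤ μ := by
    have hd : 0 < S - t * w := by
      have := mul_pos ht1' hw0
      linarith
    have : 2 * (1 - t) * (w * (b - 1)) * 1 ≤ 2 * (1 - t) * (w * (b - 1)) * μ := by
      linear_combination mul_le_mul_of_nonneg_right hst hb1.le +
        mul_le_mul_of_nonneg_right hab' hd.le - 2 * (1 - t) * h1
    exact le_of_mul_le_mul_left this (by positivity)
  have : (1 + g) * (w * (b - 1)) < (1 + g) * (w * (b - 1)) := calc
    _ < (μ * (μ + t)) * (w * (b - 1)) := by
      gcongr
      calc 1 + g < 1 * (1 + t) := by linarith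
        _ ≤ μ * (μ + t) := by gcongr
    _ = (c - 1) * (t * S) := by linarith
    _ ≤ (b - 1) * ((1 + g) * w) := by gcongr
    _ = _ := by ring
  exact this.false

/-- If `t < g`, then `r35 ≤ r14 ≤ r13`: the first balance condition gives `μ w < g t S` and
`μ + t ≤ 1 + g`, and `μ (μ + t) w < t S` contradicts the second one, as `b ≤ c`. -/
theorem ge_of_balance (hS : S ^ 2 = 4 - t ^ 2) (hH : H ^ 2 = (1 - t) * (3 + t))
    (hS0 : 0 < S) (hH0 : 0 < H) (ht0 : 0 < t) (ht1 : t < 1) (hw : w = S - H) (hw0 : 0 < w)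
    (hg : g ^ 2 + g = 1) (hg0 : 0 < g) (hk : 1 ≤ k) (hμ : 0 < μ)
    (ha : a = (1 - t)⁻¹ ^ k) (hb : b = ((1 + w ^ 2) / 4)⁻¹ ^ k) (hc : c = (t ^ 2)⁻¹ ^ k)
    (h1 : μ * w * (b - 1) = (a - 1) * (S - t * w) / 2)
    (h2 : μ * (μ + t) * w * (b - 1) = (c - 1) * t * S) : g ≤ t := by
  by_contra! hgt
  have hu := sq_le_three_sub_four_mul hS hH hS0 hH0 ht0 hg hg0 hgt.le
  have hu' := sq_le_three_sub hS hH hS0 hH0 ht1 (by nlinarith)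
  have hv := four_mul_sq_le_one_add_sq hS hH ht0 ht1 (by nlinarith)
  have hts := mul_le_one_add_mul hS hH hS0 ht0 ht1 hg hg0
  rw [← hw] at hu hu' hv hts
  have ht1' : 0 < 1 - t := by linarith
  have hp1 : 1 < (1 - t)⁻¹ := by
    rw [one_lt_inv₀ ht1']; linarith
  have hp : (1 - t)⁻¹ ≤ ((1 + w ^ 2) / 4)⁻¹ := by
    gcongr
    linarith
  have ha1 : 0 < a - 1 := by
    rw [ha]; linarith [Real.one_lt_rpow hp1 (by linarith : 0 < k)]
  have hba : a ≤ b := by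
    rw [ha, hb]
    gcongr
  have hbc : b ≤ c := by
    rw [hb, hc]
    gcongr
    linarith
  have hb1 : 0 < b - 1 := by linarith
  have hab := rpow_sub_one_mul_le hk hp1 hp
  rw [← ha, ← hb] at hab
  have hab' : (a - 1) * (1 - t) ≤ (b - 1) * (g * t) := by
    have hU : 2 + g ≤ ((1 + w ^ 2) / 4)⁻¹ := by
      rw [le_inv_comm₀ (by positivity) (by positivity), inv_eq_one_div,
        le_div_iff₀ (by positivity)]
      linear_combination (2 + g) / 4 * hu - hg
    calc (a - 1) * (1 - t) = (a - 1) * ((2 + g) - 1) * (g * (1 - t)) := by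
          linear_combination -(a - 1) * (1 - t) * hg
      _ ≤ (b - 1) * ((1 - t)⁻¹ - 1) * (g * (1 - t)) := by
        gcongr ?_ * _
        refine le_trans ?_ hab
        gcongr
      _ = (b - 1) * (g * t) := by field_simp; ring
  have hgts : g * (t * S) ≤ w := by
    linear_combination g * hts + w * hg
  have hμw : 2 * (1 - t) * (μ * w) ≤ g * t * (S - t * w) := by
    have hd : 0 < S - t * w := by
      have := mul_pos ht1' hw0
      linarith
    have : (2 * (1 - t) * (μ * w)) * (b - 1) ≤ (g * t * (S - t * w)) * (b - 1) := by
      linear_combination mul_le_mul_of_nonneg_right hab' hd.le + 2 * (1 - t) * h1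
    exact le_of_mul_le_mul_right this hb1
  have hμS : μ * w < g * (t * S) := by
    have h3 : 0 < (g - t) * (1 + g * (1 - t)) := mul_pos (by linarith) (by positivity)
    have h4 : 0 < g * t * S * ((g - t) * (1 + g * (1 - t))) := by positivity
    have h5 : (2 * (1 - t)) * (μ * w) < (2 * (1 - t)) * (g * (t * S)) := by
      linear_combination hμw + g * t ^ 2 * hgts + h4 + g * t * S * (1 - t) * hg
    exact lt_of_mul_lt_mul_left h5 (by positivity)
  have hμt : μ + t ≤ 1 + g := by
    have h3 : 2 * (1 - t) * μ ≤ 1 - g * t ^ 2 := by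
      have : w * (2 * (1 - t) * μ) ≤ w * (1 - g * t ^ 2) := by linarith
      exact le_of_mul_le_mul_left this hw0
    have h4 : 0 ≤ (g - t) * ((1 + 2 * g) * (1 + g) - (2 + g) * t) :=
      mul_nonneg (by linarith) (by
        have : (2 + g) * t ≤ (2 + g) * 1 := by gcongr
        linarith)
    have h5 : (2 * (1 - t)) * (μ + t) ≤ (2 * (1 - t)) * (1 + g) := by
      linear_combination h3 + h4 + (2 * g + 1 - 3 * t) * hg
    exact le_of_mul_le_mul_left h5 (by positivity)
  have : (t * S) * (b - 1) < (t * S) * (b - 1) := calc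
    _ ≤ (t * S) * (c - 1) := by gcongr
    _ = (μ * w) * (μ + t) * (b - 1) := by linarith
    _ ≤ (μ * w) * (1 + g) * (b - 1) := by gcongr
    _ < (g * (t * S)) * (1 + g) * (b - 1) := by gcongr
    _ = (t * S) * (b - 1) := by linear_combination (t * S) * (b - 1) * hg
  exact this.false

end Balance

/-! ### The equations of a central configuration on branch B -/

section BranchB

variable {w s : ℝ}

theorem dist_pentagon_zero_two (h : (1 + w ^ 2) * (1 + s ^ 2) = 16) :
    dist (pentagon w s 0) (pentagon w s 2) = √((3 - w * s) / 2) := by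
  simp only [pentagon, Fin.isValue, Matrix.cons_val, Plane.dist_eq]
  congr 1
  linear_combination h / 16

theorem dist_pentagon_one_four (h : (1 + w ^ 2) * (1 + s ^ 2) = 16) :
    dist (pentagon w s 1) (pentagon w s 4) = √((3 - w * s) / 2) := by
  simp only [pentagon, Fin.isValue, Matrix.cons_val, Plane.dist_eq]
  congr 1
  linear_combination h / 16

theorem dist_pentagon_zero_three : dist (pentagon w s 0) (pentagon w s 3) = √((1 + w ^ 2) / 4) := by
  simp only [pentagon, Fin.isValue, Matrix.cons_val, Plane.dist_eq]
  congr 1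
  ring

theorem dist_pentagon_one_three : dist (pentagon w s 1) (pentagon w s 3) = √((1 + w ^ 2) / 4) := by
  simp only [pentagon, Fin.isValue, Matrix.cons_val, Plane.dist_eq]
  congr 1
  ring

theorem dist_pentagon_two_four :
    dist (pentagon w s 2) (pentagon w s 4) = √(((w * s - 1) / 2) ^ 2) := by
  simp only [pentagon, Fin.isValue, Matrix.cons_val, Plane.dist_eq]
  congr 1
  ring

/-- The Laura–Andoyer equations of the pairs `1, 2`, `3, 5`, `1, 3`, `1, 4` and `3, 4`, in this order.
The oriented area `Δ_{1,3,4}` is `(s + 2 w - w ^ 2 s) / 8`. -/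
theorem balance_of_isCentralConfiguration {A a b c : ℝ} {m : Fin 5 → ℝ}
    (h : (1 + w ^ 2) * (1 + s ^ 2) = 16) (hq : IsCentralConfiguration A m (pentagon w s))
    (ha : a = ((3 - w * s) / 2)⁻¹ ^ (A / 2)) (hb : b = ((1 + w ^ 2) / 4)⁻¹ ^ (A / 2))
    (hc : c = (((w * s - 1) / 2) ^ 2)⁻¹ ^ (A / 2)) :
    (m 2 - m 4) * ((a - 1) * (w - s)) = 0 ∧
    (m 0 - m 1) * ((a - 1) * ((1 - w * s) * (w - s))) = 0 ∧
    m 3 * (b - 1) * (s + 2 * w - w ^ 2 * s) = m 4 * (c - 1) * ((1 - w * s) * (w - s)) ∧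
    m 1 * (b - 1) * (4 * w) = m 2 * (a - 1) * (s + 2 * w - w ^ 2 * s) ∧
    m 0 * (a - b) * (s + 2 * w - w ^ 2 * s) + m 1 * (b - 1) * (s + w ^ 2 * s) =
      m 4 * (c - 1) * ((w * s - 1) * (w + s)) := by
  have hws : 0 ≤ (3 - w * s) / 2 := by nlinarith [sq_nonneg (w - s)]
  have e01 := dist_pentagon_edge h 0
  have e12 := dist_pentagon_edge h 1
  have e23 := dist_pentagon_edge h 2
  have e34 := dist_pentagon_edge h 3
  have e40 := dist_pentagon_edge h 4
  have R02 : (dist (pentagon w s 0) (pentagon w s 2) ^ A)⁻¹ = a := by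
    rw [dist_pentagon_zero_two h, sqrt_rpow_inv hws, ha]
  have R14 : (dist (pentagon w s 1) (pentagon w s 4) ^ A)⁻¹ = a := by
    rw [dist_pentagon_one_four h, sqrt_rpow_inv hws, ha]
  have R03 : (dist (pentagon w s 0) (pentagon w s 3) ^ A)⁻¹ = b := by
    rw [dist_pentagon_zero_three, sqrt_rpow_inv (by positivity), hb]
  have R13 : (dist (pentagon w s 1) (pentagon w s 3) ^ A)⁻¹ = b := by
    rw [dist_pentagon_one_three, sqrt_rpow_inv (by positivity), hb]
  have R24 : (dist (pentagon w s 2) (pentagon w s 4) ^ A)⁻¹ = c := by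
    rw [dist_pentagon_two_four, sqrt_rpow_inv (by positivity), hc]
  have E (i j : Fin 5) := hq.sum_inv_dist_sub_mul_orientedArea i j
  simp only [Fin.isValue, Fin.reduceAdd, zero_add] at e01 e12 e23 e34 e40
  have E01 := E 0 1
  have E24 := E 2 4
  have E02 := E 0 2
  have E03 := E 0 3
  have E23 := E 2 3
  have e1 := dist_comm (pentagon w s 2) (pentagon w s 0)
  have e2 := dist_comm (pentagon w s 3) (pentagon w s 0)
  have e3 := dist_comm (pentagon w s 2) (pentagon w s 1)
  have e4 := dist_comm (pentagon w s 3) (pentagon w s 1)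
  have e5 := dist_comm (pentagon w s 4) (pentagon w s 1)
  have e6 := dist_comm (pentagon w s 0) (pentagon w s 4)
  have e7 := dist_comm (pentagon w s 3) (pentagon w s 2)
  have e8 := dist_comm (pentagon w s 4) (pentagon w s 2)
  have e9 := dist_comm (pentagon w s 4) (pentagon w s 3)
  simp only [Fin.sum_univ_five, e1, e2, e3, e4, e5, e6, e7, e8, e9, e01, e12, e23, e34, e40, R02,
    R14, R03, R13, R24, Real.one_rpow, inv_one, orientedArea, sub_self, mul_zero, zero_mul,
    add_zero, zero_add] at E01 E24 E02 E03 E23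
  simp [pentagon] at E01 E24 E02 E03 E23
  refine ⟨?_, ?_, ?_, ?_, ?_⟩
  · linear_combination 4 * E01
  · linear_combination 8 * E24
  · linear_combination 8 * E02
  · linear_combination 8 * E03
  · linear_combination 8 * E23

end BranchB

/-! ### Uniqueness -/

section Uniqueness

variable {w s A g : ℝ} {m : Fin 5 → ℝ}

/-- Positivity of the masses restricts a central configuration to the arc `w < s`, `1 < w s`, that
is, `y_3 < 0` and `x_3 < 0`: elsewhere on branch B the equations of the pairs `1, 3` and `1, 4` have
incompatible signs, or two bodies collide. -/
theorem IsCentralConfiguration.lt_and_one_lt (hw : 0 ≤ w) (hs : 0 ≤ s)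
    (h : (1 + w ^ 2) * (1 + s ^ 2) = 16) (hA : 0 < A) (hm : ∀ i, 0 < m i)
    (hq : IsCentralConfiguration A m (pentagon w s)) : w < s ∧ 1 < w * s := by
  obtain ⟨-, -, E02, E03, -⟩ := balance_of_isCentralConfiguration h hq rfl rfl rfl
  set a := ((3 - w * s) / 2)⁻¹ ^ (A / 2) with ha
  set b := ((1 + w ^ 2) / 4)⁻¹ ^ (A / 2) with hb
  set c := (((w * s - 1) / 2) ^ 2)⁻¹ ^ (A / 2) with hc
  have hA2 : 0 < A / 2 := by positivity
  -- For `w = s` the bodies 1 and 3 collide, for `w s = 1` the bodies 3 and 5 do.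
  have hne : w ≠ s := by
    rintro rfl
    have h3 : w * w = 3 := by
      have : (w * w - 3) * (w * w + 5) = 0 := by linear_combination h
      rcases mul_eq_zero.1 this with h | h <;> nlinarith
    have : pentagon w w 0 = pentagon w w 2 := by simp [pentagon, h3]; norm_num
    exact absurd (hq.1 this) (by decide)
  have hne' : w * s ≠ 1 := by
    intro h1
    have : pentagon w s 2 = pentagon w s 4 := by simp [pentagon, h1]
    exact absurd (hq.1 this) (by decide)
  have hlt : w * s < 3 := by
    have : 0 < (w - s) ^ 2 := by
      have := sub_ne_zero.2 hne
      positivity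
    nlinarith [mul_nonneg hw hs]
  have hc1 : 0 < c - 1 := by
    have : 0 < ((w * s - 1) / 2) ^ 2 := by
      have := sub_ne_zero.2 hne'
      positivity
    have := one_lt_inv_rpow this (by nlinarith [mul_nonneg hw hs]) hA2
    linarith
  have m1 := hm 1
  have m2 := hm 2
  have m3 := hm 3
  have m4 := hm 4
  rcases lt_or_gt_of_ne hne with hws | hws
  · refine ⟨hws, ?_⟩
    by_contra! hle
    have hle := lt_of_le_of_ne hle hne'
    have hw3 : w ^ 2 < 3 := by
      by_contra! h3
      nlinarith
    have hb1 : 0 < b - 1 := by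
      have := one_lt_inv_rpow (x := (1 + w ^ 2) / 4) (by positivity) (by linarith) hA2
      linarith
    have hD : 0 < s + 2 * w - w ^ 2 * s := by nlinarith
    have : 0 < m 3 * (b - 1) * (s + 2 * w - w ^ 2 * s) := by positivity
    have : 0 < m 4 * (c - 1) * ((1 - w * s) * (s - w)) :=
      mul_pos (by positivity) (mul_pos (by linarith) (by linarith))
    linarith
  · exfalso
    have hw3 : 3 < w ^ 2 := by
      by_contra! h3
      nlinarith
    have hb1 : b - 1 < 0 := by
      have := inv_rpow_lt_one (x := (1 + w ^ 2) / 4) (by linarith) hA2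
      linarith
    have hw0 : 0 < w := by linarith
    have hL : m 1 * (b - 1) * (4 * w) < 0 :=
      mul_neg_of_neg_of_pos (mul_neg_of_pos_of_neg m1 hb1) (by positivity)
    rcases lt_or_gt_of_ne hne' with hx | hx
    · have ha1 : a - 1 < 0 := by
        have := inv_rpow_lt_one (x := (3 - w * s) / 2) (by linarith) hA2
        linarith
      have hD : 0 < s + 2 * w - w ^ 2 * s := by
        by_contra! hD
        linarith [mul_nonneg_of_nonpos_of_nonpos (mul_neg_of_pos_of_neg m2 ha1).le hD]
      have := mul_neg_of_neg_of_pos (mul_neg_of_pos_of_neg m3 hb1) hD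
      have : 0 < m 4 * (c - 1) * ((1 - w * s) * (w - s)) :=
        mul_pos (by positivity) (mul_pos (by linarith) (by linarith))
      linarith
    · have ha1 : 0 < a - 1 := by
        have := one_lt_inv_rpow (x := (3 - w * s) / 2) (by linarith) (by linarith) hA2
        linarith
      have hD : s + 2 * w - w ^ 2 * s < 0 := by
        by_contra! hD
        have : 0 ≤ m 2 * (a - 1) * (s + 2 * w - w ^ 2 * s) := by positivity
        linarith
      have := mul_pos_of_neg_of_neg (mul_neg_of_pos_of_neg m3 hb1) hD
      have : 0 < m 4 * (c - 1) * ((w * s - 1) * (w - s)) :=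
        mul_pos (by positivity) (mul_pos (by linarith) (by linarith))
      linarith

/-- A central configuration on branch B has the shape of the regular pentagon and equal masses. -/
theorem IsCentralConfiguration.eq_regular (hw : 0 ≤ w) (hs : 0 ≤ s)
    (h : (1 + w ^ 2) * (1 + s ^ 2) = 16) (hA : 2 ≤ A) (hm : ∀ i, 0 < m i)
    (hg : g ^ 2 + g = 1) (hg0 : 0 < g) (hq : IsCentralConfiguration A m (pentagon w s)) :
    w ^ 2 = 3 - 4 * g ∧ s = (3 + 2 * g) * w ∧ ∀ i j, m i = m j := by
  obtain ⟨hws, hws1⟩ := hq.lt_and_one_lt hw hs h (by linarith) hm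
  have hw0 : 0 < w := by
    rcases hw.eq_or_lt with rfl | h
    · linarith
    · exact h
  obtain ⟨E01, E24, E02, E03, E23⟩ := balance_of_isCentralConfiguration h hq rfl rfl rfl
  obtain ⟨t, ht⟩ : ∃ t, t = (w * s - 1) / 2 := ⟨_, rfl⟩
  obtain ⟨S, hSe⟩ : ∃ S, S = (s + w) / 2 := ⟨_, rfl⟩
  obtain ⟨H, hHe⟩ : ∃ H, H = (s - w) / 2 := ⟨_, rfl⟩
  have ht' : (3 - w * s) / 2 = 1 - t := by linarith
  rw [ht'] at E01 E24 E03 E23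
  rw [← ht] at E02 E23
  obtain ⟨a, ha⟩ : ∃ a, a = (1 - t)⁻¹ ^ (A / 2) := ⟨_, rfl⟩
  obtain ⟨b, hb⟩ : ∃ b, b = ((1 + w ^ 2) / 4)⁻¹ ^ (A / 2) := ⟨_, rfl⟩
  obtain ⟨c, hc⟩ : ∃ c, c = (t ^ 2)⁻¹ ^ (A / 2) := ⟨_, rfl⟩
  rw [← ha] at E01 E24 E03 E23
  rw [← hb] at E02 E03 E23
  rw [← hc] at E02 E23
  have hts : w * s = 1 + 2 * t := by linarith
  have hS : S ^ 2 = 4 - t ^ 2 := by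
    rw [hSe, ht]; linear_combination h / 4
  have hH : H ^ 2 = (1 - t) * (3 + t) := by
    rw [hHe, ht]; linear_combination h / 4
  have hS0 : 0 < S := by linarith
  have hH0 : 0 < H := by linarith
  have ht0 : 0 < t := by linarith
  have ht1 : t < 1 := by
    have : 0 < (1 - t) * (3 + t) := hH ▸ pow_pos hH0 2
    linarith [pos_of_mul_pos_left this (by linarith)]
  have hwSH : w = S - H := by linarith
  have hw3 : w ^ 2 < 3 := by
    have h3 : w ^ 2 < s ^ 2 := by gcongr
    have h4 : (1 + w ^ 2) * (1 + w ^ 2) < 4 * 4 := by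
      calc _ < (1 + w ^ 2) * (1 + s ^ 2) := by gcongr
        _ = 4 * 4 := by rw [h]; norm_num
    linarith [lt_of_mul_self_lt_mul_self₀ (by norm_num) h4]
  have hA2 : 1 ≤ A / 2 := by linarith
  have ha1 : 0 < a - 1 := by
    have := one_lt_inv_rpow (x := 1 - t) (by linarith) (by linarith) (by linarith : 0 < A / 2)
    linarith
  have hm24 : m 2 = m 4 := by
    have : (a - 1) * (w - s) ≠ 0 := mul_ne_zero ha1.ne' (by linarith)
    linarith [(mul_eq_zero.1 E01).resolve_right this]
  have hm01 : m 0 = m 1 := by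
    have : (a - 1) * ((1 - w * s) * (w - s)) ≠ 0 :=
      mul_ne_zero ha1.ne' (mul_ne_zero (by linarith) (by linarith))
    linarith [(mul_eq_zero.1 E24).resolve_right this]
  obtain ⟨μ, hμ⟩ : ∃ μ, μ = m 1 / m 4 := ⟨_, rfl⟩
  have m4 := hm 4
  have hμ0 : 0 < μ := hμ ▸ div_pos (hm 1) m4
  have hm1 : m 1 = μ * m 4 := by rw [hμ]; field_simp
  rw [hm24, hm1] at E03
  rw [hm01, hm1] at E23
  have hD : s + 2 * w - w ^ 2 * s = 2 * (S - t * w) := by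
    rw [hSe, ht]; ring
  have h1 : μ * w * (b - 1) = (a - 1) * (S - t * w) / 2 := by
    apply mul_left_cancel₀ m4.ne'
    rw [hD] at E03
    linear_combination E03 / 4
  have h2 : μ * (μ + t) * w * (b - 1) = (c - 1) * t * S := by
    apply mul_left_cancel₀ m4.ne'
    have hN : s + w ^ 2 * s = 2 * (S - t * w) + 4 * (t * w) := by
      rw [hSe, ht]; ring
    have hR : (w * s - 1) * (w + s) = 4 * (t * S) := by
      rw [hSe, ht]; ring
    rw [hD, hN, hR] at E23
    linear_combination E23 / 4 + m 4 * μ * h1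
  -- The shape is regular, so the three distances `r13`, `r14`, `r35` agree and the equations
  -- give the mass ratios.
  have htg : t = g := le_antisymm
    (le_of_balance hS hH hS0 hH0 ht0 ht1 hwSH hw0 hw3 hg hg0 hA2 ha hb hc h1 h2)
    (ge_of_balance hS hH hS0 hH0 ht0 ht1 hwSH hw0 hg hg0 hA2 hμ0 ha hb hc h1 h2)
  subst htg
  have hw2 : w ^ 2 = 3 - 4 * t := by
    rw [hwSH]
    exact le_antisymm (sq_le_three_sub hS hH hS0 hH0 ht1 (by linarith))
      (three_sub_le_sq hS hH ht0 ht1 (by linarith))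
  have hab : b = a := by
    rw [hb, ha, hw2]; ring_nf
  have hac : c = a := by
    rw [hc, ha, ← hg]; ring_nf
  rw [hab] at h1 h2 E02
  rw [hac] at h2 E02
  have h1' : μ * w = (S - t * w) / 2 := mul_right_cancel₀ ha1.ne' (by rw [h1]; ring)
  have h2' : μ * (μ + t) * w = t * S := mul_right_cancel₀ ha1.ne' (by rw [h2]; ring)
  have hμ1 : μ = 1 := by
    have h3 : (μ - 1) * (w * (μ + 1 - t)) = 0 := by
      linear_combination h2' - 2 * t * h1' + w * hg
    have h4 : w * (μ + 1 - t) ≠ 0 := (mul_pos hw0 (by linarith)).ne'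
    linarith [(mul_eq_zero.1 h3).resolve_right h4]
  subst hμ1
  have hSw : s = (3 + 2 * t) * w := by linear_combination -4 * h1' - 2 * hSe
  refine ⟨hw2, hSw, ?_⟩
  have hm34 : m 3 = m 4 := by
    have hL : s + 2 * w - w ^ 2 * s = 4 * w := by linear_combination hD - 4 * h1'
    have hR : (1 - w * s) * (w - s) = 4 * w := by
      rw [hts, hSw]
      linear_combination 4 * w * hg
    rw [hL, hR] at E02
    have h3 : (a - 1) * (4 * w) ≠ 0 := (mul_pos ha1 (by linarith)).ne'
    exact mul_right_cancel₀ h3 (by linear_combination E02)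
  have hall : ∀ i, m i = m 4 := by
    intro i
    fin_cases i
    · simpa [hm01] using hm1
    · simpa using hm1
    · exact hm24
    · exact hm34
    · rfl
  intro i j
  rw [hall i, hall j]

end Uniqueness

/-! ### The regular pentagon -/

theorem cos_two_pi_div_five : Real.cos (2 * Real.pi / 5) = (√5 - 1) / 4 := by
  rw [mul_div_assoc, Real.cos_two_mul, Real.cos_pi_div_five]
  have := Real.sq_sqrt (show (0 : ℝ) ≤ 5 by norm_num)
  linear_combination this / 8

section Regular

-- With `g = (√5 - 1) / 2`, the regular pentagon is the point `w ^ 2 = 3 - 4 g`, `s = (3 + 2 g) w` of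
-- branch B; its side, the short distance between two bodies, is `g`, and its diagonal is `1`.
variable {g w : ℝ}

theorem regular_norm (hg : g ^ 2 + g = 1) (hw : w ^ 2 = 3 - 4 * g) :
    (1 + w ^ 2) * (1 + ((3 + 2 * g) * w) ^ 2) = 16 := by
  rw [mul_pow, hw]
  have e : g ^ 2 = 1 - g := by linarith
  have e3 : g ^ 3 = 2 * g - 1 := by linear_combination (g - 1) * hg
  have e4 : g ^ 4 = 2 - 3 * g := by linear_combination (g ^ 2 - g + 2) * hg
  ring_nf
  rw [e, e3, e4]
  ring

theorem regular_mul (hg : g ^ 2 + g = 1) (hw : w ^ 2 = 3 - 4 * g) :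
    w * ((3 + 2 * g) * w) = 1 + 2 * g := by
  linear_combination (3 + 2 * g) * hw - 8 * hg

theorem regular_eq (hg : g ^ 2 + g = 1) (hw : w ^ 2 = 3 - 4 * g) :
    pentagon w ((3 + 2 * g) * w) =
      ![!₂[-1 / 2, 0], !₂[1 / 2, 0], !₂[-g / 2, -(1 + g) * w / 2], !₂[0, w / 2],
        !₂[g / 2, -(1 + g) * w / 2]] := by
  rw [pentagon, regular_mul hg hw]
  ext i k
  fin_cases i <;> fin_cases k <;> simp <;> ring

theorem dist_regular_diagonal (hg : g ^ 2 + g = 1) (hg0 : 0 < g) (hw : w ^ 2 = 3 - 4 * g)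
    (i : Fin 5) :
    dist (pentagon w ((3 + 2 * g) * w) i) (pentagon w ((3 + 2 * g) * w) (i + 2)) = g := by
  have h := regular_norm hg hw
  have hm := regular_mul hg hw
  have ha : √((3 - w * ((3 + 2 * g) * w)) / 2) = g := by
    rw [hm, ← Real.sqrt_sq hg0.le]; congr 1; rw [Real.sqrt_sq hg0.le]; linear_combination -hg
  have hb : √((1 + w ^ 2) / 4) = g := by
    rw [hw, ← Real.sqrt_sq hg0.le]; congr 1; rw [Real.sqrt_sq hg0.le]; linear_combination -hg
  fin_cases i
  · exact (dist_pentagon_zero_two h).trans ha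
  · exact dist_pentagon_one_three.trans hb
  · refine dist_pentagon_two_four.trans ?_
    rw [hm, ← Real.sqrt_sq hg0.le]; congr 1; rw [Real.sqrt_sq hg0.le]; ring
  · rw [dist_comm]
    exact dist_pentagon_zero_three.trans hb
  · rw [dist_comm]
    exact (dist_pentagon_one_four h).trans ha

theorem regular_injective (hg : g ^ 2 + g = 1) (hg0 : 0 < g) (hw : w ^ 2 = 3 - 4 * g) :
    Function.Injective (pentagon w ((3 + 2 * g) * w)) := by
  have h1 := dist_pentagon_edge (regular_norm hg hw)
  have h2 := dist_regular_diagonal hg hg0 hw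
  have key (i : Fin 5) : pentagon w ((3 + 2 * g) * w) i ≠ pentagon w ((3 + 2 * g) * w) (i + 1) ∧
      pentagon w ((3 + 2 * g) * w) i ≠ pentagon w ((3 + 2 * g) * w) (i + 2) :=
    ⟨dist_pos.1 (h1 i ▸ one_pos), dist_pos.1 ((h2 i).symm ▸ hg0)⟩
  intro i j hij
  have : i = j ∨ j = i + 1 ∨ j = i + 2 ∨ i = j + 1 ∨ i = j + 2 := by
    clear hij; revert i j; decide
  rcases this with h | rfl | rfl | rfl | rfl
  · exact h
  · exact absurd hij (key i).1
  · exact absurd hij (key i).2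
  · exact absurd hij.symm (key j).1
  · exact absurd hij.symm (key j).2

/-- Distinct points of a sphere are in strictly convex position: the linear functional given by the
radius at one of them is larger there than at all the others. -/
theorem convexIndependent_of_dist_eq {E ι : Type*} [NormedAddCommGroup E] [InnerProductSpace ℝ E]
    {q : ι → E} (hq : Function.Injective q) {c : E} {R : ℝ} (hR : ∀ i, dist (q i) c = R) :
    ConvexIndependent ℝ q := by
  intro s x hx
  by_contra hxs
  have hsub : convexHull ℝ (q '' s) ⊆ {z | inner ℝ (q x - c) z < inner ℝ (q x - c) (q x)} := by
    refine convexHull_min ?_ (convex_halfSpace_lt (innerₗ E (q x - c)).isLinear _)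
    rintro _ ⟨y, hy, rfl⟩
    have hne : q x - q y ≠ 0 := sub_ne_zero.2 fun h => hxs (hq h ▸ hy)
    have h0 : ‖q y - c‖ = ‖q x - c‖ := by rw [← dist_eq_norm, ← dist_eq_norm, hR, hR]
    have h3 : q x - c - (q x - q y) = q y - c := by abel
    have h4 : 0 < ‖q x - q y‖ := norm_pos_iff.2 hne
    have h2 := norm_sub_sq_real (q x - c) (q x - q y)
    rw [h3, h0, inner_sub_right] at h2
    change inner ℝ (q x - c) (q y) < inner ℝ (q x - c) (q x)
    nlinarith
  exact lt_irrefl (inner ℝ (q x - c) (q x)) (hsub hx)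

theorem regular_isTypeB2 (hg : g ^ 2 + g = 1) (hg0 : 0 < g) (hw0 : 0 < w)
    (hw : w ^ 2 = 3 - 4 * g) : IsTypeB2 (pentagon w ((3 + 2 * g) * w)) := by
  have hg1 : g < 1 := by nlinarith
  have hd := dist_regular_diagonal hg hg0 hw
  have h30 := hd 3
  rw [dist_comm] at h30
  refine ⟨?_, ?_, ?_, ?_, ?_, ?_, (hd 0).trans_lt hg1, h30.trans_lt hg1, (hd 2).trans_lt hg1⟩
  · refine convexIndependent_of_dist_eq (regular_injective hg hg0 hw)
      (c := !₂[0, -(1 + 2 * g) * w / 10]) (R := √(2 / 5 - g / 5)) fun i => ?_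
    rw [regular_eq hg hw]
    fin_cases i <;> simp [Plane.dist_eq] <;> congr 1
    · linear_combination (1 + 2 * g) ^ 2 / 100 * hw + (3 - 4 * g) / 25 * hg
    · linear_combination (1 + 2 * g) ^ 2 / 100 * hw + (3 - 4 * g) / 25 * hg
    · linear_combination (4 + 3 * g) ^ 2 / 100 * hw - (9 * g + 2) / 25 * hg
    · linear_combination (6 + 2 * g) ^ 2 / 100 * hw - (4 * g + 17) / 25 * hg
    · linear_combination (4 + 3 * g) ^ 2 / 100 * hw - (9 * g + 2) / 25 * hg
  all_goals
    rw [regular_eq hg hw]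
    simp [orientedArea]
  · nlinarith
  · nlinarith
  · nlinarith
  · nlinarith
  · nlinarith

theorem regular_isCentralConfiguration (hg : g ^ 2 + g = 1) (hg0 : 0 < g)
    (hw : w ^ 2 = 3 - 4 * g) (A : ℝ) {μ : ℝ} (hμ : 0 < μ) {m : Fin 5 → ℝ} (hm : ∀ i, m i = μ) :
    IsCentralConfiguration A m (pentagon w ((3 + 2 * g) * w)) := by
  -- The differences to the two bodies at distance `1` sum to `(3 + g) (q_i - c)`, those to the two
  -- bodies at distance `g` to `(2 - g) (q_i - c)`.
  refine ⟨regular_injective hg hg0 hw, μ * ((3 + g) + (g ^ A)⁻¹ * (2 - g)), fun i => ?_⟩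
  have h1 := dist_pentagon_edge (regular_norm hg hw)
  have h2 := dist_regular_diagonal hg hg0 hw
  set q := pentagon w ((3 + 2 * g) * w) with hq
  rw [regular_eq hg hw] at hq
  have hc : centerOfMass m q = !₂[0, -(1 + 2 * g) * w / 10] := by
    rw [centerOfMass]
    simp only [hm]
    rw [← Finset.smul_sum, smul_smul, hq]
    ext k
    fin_cases k
    · simp [Fin.sum_univ_five]
      ring
    · simp [Fin.sum_univ_five]
      field_simp
      ring
  have hsum : ∑ j ∈ Finset.univ.erase i, (m j / dist (q i) (q j) ^ A) • (q i - q j) =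
      μ • ((q i - q (i + 1)) + (q i - q (i + 4))) +
        (μ * (g ^ A)⁻¹) • ((q i - q (i + 2)) + (q i - q (i + 3))) := by
    have h3 := h2 (i + 3)
    have h4 := h1 (i + 4)
    rw [add_assoc, show (3 + 2 : Fin 5) = 0 from rfl, add_zero, dist_comm] at h3
    rw [add_assoc, show (4 + 1 : Fin 5) = 0 from rfl, add_zero, dist_comm] at h4
    rw [Finset.sum_erase _ (by simp), ← Equiv.sum_comp (Equiv.addLeft i)]
    simp only [Fin.sum_univ_five, Equiv.coe_addLeft, hm, h1, h2, h3, h4, add_zero, sub_self,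
      smul_zero, Real.one_rpow, zero_add, div_eq_mul_inv μ]
    module
  rw [hsum, hc]
  generalize (g ^ A)⁻¹ = ρ
  rw [hq]
  ext k
  fin_cases i <;> fin_cases k <;> simp
  · ring
  · linear_combination μ * w * (1 - ρ) / 5 * hg
  · ring
  · linear_combination μ * w * (1 - ρ) / 5 * hg
  · linear_combination μ * (ρ - 1) / 2 * hg
  · linear_combination 3 * μ * w * (ρ - 1) / 10 * hg
  · ring
  · linear_combination μ * w * (1 - ρ) / 5 * hg
  · linear_combination μ * (1 - ρ) / 2 * hg
  · linear_combination 3 * μ * w * (ρ - 1) / 10 * hg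

end Regular

theorem isRegularPentagon_regular {g w : ℝ} (hg : g = 2 * Real.cos (2 * Real.pi / 5))
    (hg2 : g ^ 2 + g = 1) (hw0 : 0 < w) (hw : w ^ 2 = 3 - 4 * g) :
    IsRegularPentagon (pentagon w ((3 + 2 * g) * w)) := by
  set α := 2 * Real.pi / 5 with hα
  have hs0 : 0 < Real.sin α :=
    Real.sin_pos_of_pos_of_lt_pi (by positivity) (by linarith [Real.pi_pos])
  set r := Real.sin α with hr
  have hcos : Real.cos α = g / 2 := by linarith
  have hr2 : r ^ 2 = 1 - g ^ 2 / 4 := by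
    rw [hr, Real.sin_sq, hcos]; ring
  have hwr : w * r = 1 - g / 2 := by
    have hg1 : g < 2 := by nlinarith
    refine (pow_left_inj₀ (by positivity) (by linarith) two_ne_zero).1 ?_
    rw [mul_pow, hw, hr2]
    linear_combination (g - 2) * hg2
  have hwr' : w = (1 - g / 2) / r := by rw [← hwr]; field_simp
  have hcos2 : Real.cos (2 * α) = -(1 + g) / 2 := by
    rw [Real.cos_two_mul, hcos]; linear_combination hg2 / 2
  have hsin2 : Real.sin (2 * α) = g * r := by
    rw [Real.sin_two_mul, hcos]; ring
  have hcos3 : Real.cos (3 * α) = -(1 + g) / 2 := by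
    rw [← hcos2, ← Real.cos_two_pi_sub]; congr 1; rw [hα]; ring
  have hsin3 : Real.sin (3 * α) = -(g * r) := by
    rw [← hsin2, ← neg_neg (Real.sin (3 * α)), ← Real.sin_two_pi_sub]; congr 2; rw [hα]; ring
  have hcos4 : Real.cos (4 * α) = g / 2 := by
    rw [← hcos, ← Real.cos_two_pi_sub]; congr 1; rw [hα]; ring
  have hsin4 : Real.sin (4 * α) = -r := by
    rw [hr, ← neg_neg (Real.sin (4 * α)), ← Real.sin_two_pi_sub]; congr 2; rw [hα]; ring
  have hang (k : ℕ) : Real.pi / 2 + 2 * Real.pi * (k : ℝ) / 5 = k * α + Real.pi / 2 := by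
    rw [hα]; ring
  -- The counterclockwise order of the vertices, from the top one on the axis of symmetry.
  have hbij : Function.Bijective (![3, 0, 2, 4, 1] : Fin 5 → Fin 5) := by decide
  refine ⟨Equiv.ofBijective _ hbij, !₂[0, -(g / 2) / (2 * r)], 1 / (2 * r), Real.pi / 2,
    by positivity, fun k => ?_⟩
  simp only [hang, Real.cos_add_pi_div_two, Real.sin_add_pi_div_two, Equiv.ofBijective_apply]
  rw [regular_eq hg2 hw]
  ext l
  fin_cases k <;> fin_cases l <;>
    simp [hcos, hcos2, hcos3, hcos4, hsin2, hsin3, hsin4, ← hr, hwr'] <;> field_simp <;> ring_nf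
  · linear_combination hg2
  · linear_combination hg2

theorem theorem3 :
    ∃ q : Fin 5 → Plane, IsBranchB q ∧ IsRegularPentagon q ∧ IsTypeB2 q ∧
      ∀ A : ℝ, 2 ≤ A → ∀ m : Fin 5 → ℝ, (∀ i, 0 < m i) → ∀ p : Fin 5 → Plane, IsBranchB p →
        (IsCentralConfiguration A m p ↔ p = q ∧ ∀ i j, m i = m j) := by
  obtain ⟨g, hg⟩ : ∃ g, g = 2 * Real.cos (2 * Real.pi / 5) := ⟨_, rfl⟩
  have h5 := Real.sq_sqrt (show (0 : ℝ) ≤ 5 by norm_num)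
  have hg' : g = (√5 - 1) / 2 := by
    rw [hg, cos_two_pi_div_five]; ring
  have hg2 : g ^ 2 + g = 1 := by
    rw [hg']; linear_combination h5 / 4
  have hg0 : 0 < g := by
    have : 1 < √5 := by rw [Real.lt_sqrt] <;> norm_num
    linarith
  have hg3 : 0 < 3 - 4 * g := by nlinarith
  obtain ⟨w, hw⟩ : ∃ w, w = √(3 - 4 * g) := ⟨_, rfl⟩
  have hw0 : 0 < w := hw ▸ Real.sqrt_pos.2 hg3
  have hw2 : w ^ 2 = 3 - 4 * g := by rw [hw, Real.sq_sqrt hg3.le]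
  refine ⟨pentagon w ((3 + 2 * g) * w),
    isBranchB_pentagon hw0.le (by positivity) (regular_norm hg2 hw2),
    isRegularPentagon_regular hg hg2 hw0 hw2, regular_isTypeB2 hg2 hg0 hw0 hw2, ?_⟩
  intro A hA m hm p hp
  constructor
  · intro hc
    obtain ⟨w', s, hw', hs, h, rfl⟩ := hp.exists_eq_pentagon
    obtain ⟨h1, h2, h3⟩ := hc.eq_regular hw' hs h hA hm hg2 hg0
    have : w' = w := by
      rw [hw, ← h1, Real.sqrt_sq hw']
    rw [h2, this]
    exact ⟨rfl, h3⟩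
  · rintro ⟨rfl, hmm⟩
    exact regular_isCentralConfiguration hg2 hg0 hw2 A (hm 0) fun i => hmm i 0
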